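/- Let $\mathbb{K}\in\{\mathbb{R},\mathbb{C}\}$, let $X$ be an infinite-dimensional normed space over $\mathbb{K}$, and let $\mathcal{F}$ be a free filter on $\mathbb{N}=\{0,1,2,\dots\}$, i.e. a proper filter containing every cofinite subset of $\mathbb{N}$. A set $A\subseteq\mathbb{N}$ is called $\mathcal{F}$-stationary if $\mathbb{N}\setminus A\notin\mathcal{F}$, and $A\subseteq^* B$ means that $A\setminus B$ is finite. For a topological vector space $Y$ over $\mathbb{K}$, a sequence $(T_i)_{i\in\mathbb{N}}$ of continuous linear maps from $X$ to $Y$ is called * pointwise $\mathcal{F}$-bounded if for every $x\in X$ and every $0$-neighbourhood $V$ in $Y$ there is $t>0$ with $\{i: tT_i(x)\in V\}\in\mathcal{F}$; * $\mathcal{F}$-equicontinuous if for every $0$-neighbourhood $V$ in $Y$ there is a $0$-neighbourhood $U$ in $X$ with $\{i: T_i[U]\subseteq V\}\in\mathcal{F}$; * $\mathcal{F}$-stationary-equicontinuous if for every $\mathcal{F}$-stationary set $I$ and every $0$-neighbourhood $V$ in $Y$ there are a $0$-neighbourhood $U$ in $X$ and an $\mathcal{F}$-stationary set $J\subseteq I$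 with $T_i[U]\subseteq V$ for all $i\in J$. The uniform $\mathcal{F}$-boundedness principle holds for $X$ if for every locally convex space $Y$ over $\mathbb{K}$ the pointwise $\mathcal{F}$-bounded sequences of continuous linear maps from $X$ to $Y$ are exactly the $\mathcal{F}$-equicontinuous ones. The stationary uniform $\mathcal{F}$-boundedness principle holds for $X$ if for every locally convex space $Y$ over $\mathbb{K}$ every pointwise $\mathcal{F}$-bounded sequence of continuous linear maps from $X$ to $Y$ is $\mathcal{F}$-stationary-equicontinuous. The filter $\mathcal{F}$ is a $P^+$-filter if for every decreasing sequence $(A_k)_k$ of $\mathcal{F}$-stationary sets there is an $\mathcal{F}$-stationary set $B$ with $B\subseteq^* A_k$ for every $k$. It is a weak $P^+$-filter if for every decreasing sequence $(A_k)_k$ of elements of $\mathcal{F}$ and every $\mathcal{F}$-stationary set $I$ there is an $\mathcal{F}$-stationary set $B\subseteq I$ with $B\subseteq^* A_k$ for every $k$. Then: (a) if the uniform $\mathcal{F}$-boundedness principle holds for $X$, then $\mathcal{F}$ is a $P^+$-filter; (b) if the stationary uniform $\mathcal{F}$-boundedness principle holds for $X$, then $\mathcal{F}$ is a weak $P^+$-filter.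 -/

import Mathlib

universe u v

namespace FilterUBP

open Filter Topology

/-- `A` is `F`-stationary when its complement does not belong to `F`, i.e. `A` does not lie in the
dual ideal of `F`. -/
def Stationary (F : Filter ℕ) (A : Set ℕ) : Prop :=
  Aᶜ ∉ F

/-- `A ⊆* B`: inclusion modulo a finite set. -/
def AlmostSubset (A B : Set ℕ) : Prop :=
  (A \ B).Finite

/-- `P⁺`-filters: every decreasing sequence of `F`-stationary sets has an `F`-stationary
pseudo-intersection. -/
def IsPPlus (F : Filter ℕ) : Prop :=
  ∀ A : ℕ → Set ℕ, Antitone A → (∀ k, Stationary F (A k)) →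
    ∃ B : Set ℕ, Stationary F B ∧ ∀ k, AlmostSubset B (A k)

/-- weak `P⁺`-filters: for every decreasing sequence of elements of `F`, every `F`-stationary set
contains an `F`-stationary pseudo-intersection of the sequence. -/
def IsWeakPPlus (F : Filter ℕ) : Prop :=
  ∀ A : ℕ → Set ℕ, Antitone A → (∀ k, A k ∈ F) →
    ∀ I : Set ℕ, Stationary F I →
      ∃ B : Set ℕ, B ⊆ I ∧ Stationary F B ∧ ∀ k, AlmostSubset B (A k)

section TVS

variable (𝕜 : Type*) [RCLike 𝕜]

/-- `F`-bounded sequences in a topological vector space over `ℝ` or `ℂ`. -/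
def FBounded (F : Filter ℕ) {Y : Type*} [AddCommGroup Y] [Module 𝕜 Y] [TopologicalSpace Y]
    (x : ℕ → Y) : Prop :=
  ∀ U ∈ 𝓝 (0 : Y), ∃ t : ℝ, 0 < t ∧ ∀ᶠ i in F, (t : 𝕜) • x i ∈ U

variable {𝕜}
variable {X Y : Type*} [AddCommGroup X] [Module 𝕜 X] [TopologicalSpace X]
  [AddCommGroup Y] [Module 𝕜 Y] [TopologicalSpace Y]

def PointwiseFBounded (F : Filter ℕ) (T : ℕ → X →L[𝕜] Y) : Prop :=
  ∀ x : X, FBounded 𝕜 F (fun i => T i x)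

def FEquicontinuous (F : Filter ℕ) (T : ℕ → X →L[𝕜] Y) : Prop :=
  ∀ V ∈ 𝓝 (0 : Y), ∃ U ∈ 𝓝 (0 : X), ∀ᶠ i in F, T i '' U ⊆ V

def FStationaryEquicontinuous (F : Filter ℕ) (T : ℕ → X →L[𝕜] Y) : Prop :=
  ∀ I : Set ℕ, Stationary F I → ∀ V ∈ 𝓝 (0 : Y), ∃ U ∈ 𝓝 (0 : X),
    ∃ J : Set ℕ, Stationary F J ∧ J ⊆ I ∧ ∀ i ∈ J, T i '' U ⊆ V

variable (𝕜 X Y)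

/-- `UBP_F(X, Y)`: the pointwise `F`-bounded sequences of continuous linear maps from `X` to `Y` are
exactly the `F`-equicontinuous ones. -/
def UBPBetween (F : Filter ℕ) : Prop :=
  {T : ℕ → X →L[𝕜] Y | PointwiseFBounded F T} = {T : ℕ → X →L[𝕜] Y | FEquicontinuous F T}

/-- `UBP^stat_F(X, Y)`. -/
def StatUBPBetween (F : Filter ℕ) : Prop :=
  ∀ T : ℕ → X →L[𝕜] Y, PointwiseFBounded F T → FStationaryEquicontinuous F T

end TVS

/-- The uniform `F`-boundedness principle holds for `X`: `UBP_F(X, Y)` holds for every locally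
convex topological vector space `Y` (in the universe `v`) over the same scalar field. The real
structure on `Y`, used to speak of convex sets, is the restriction of the `𝕜`-structure. -/
def UBP (𝕜 : Type*) [RCLike 𝕜] (F : Filter ℕ)
    (X : Type*) [AddCommGroup X] [Module 𝕜 X] [TopologicalSpace X] : Prop :=
  ∀ (Y : Type v) [AddCommGroup Y] [Module 𝕜 Y] [Module ℝ Y] [IsScalarTower ℝ 𝕜 Y]
    [TopologicalSpace Y] [IsTopologicalAddGroup Y] [ContinuousSMul 𝕜 Y] [LocallyConvexSpace ℝ Y],
    UBPBetween 𝕜 X Y F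

/-- The stationary uniform `F`-boundedness principle holds for `X`: `UBP^stat_F(X, Y)` holds for
every locally convex topological vector space `Y` (in the universe `v`) over the same scalar
field. -/
def StatUBP (𝕜 : Type*) [RCLike 𝕜] (F : Filter ℕ)
    (X : Type*) [AddCommGroup X] [Module 𝕜 X] [TopologicalSpace X] : Prop :=
  ∀ (Y : Type v) [AddCommGroup Y] [Module 𝕜 Y] [Module ℝ Y] [IsScalarTower ℝ 𝕜 Y]
    [TopologicalSpace Y] [IsTopologicalAddGroup Y] [ContinuousSMul 𝕜 Y] [LocallyConvexSpace ℝ Y],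
    StatUBPBetween 𝕜 X Y F

end FilterUBP

/-!
Both implications are proved by contraposition, with functionals as the linear maps. Suppose that a
decreasing sequence `A` has no stationary pseudo-intersection (inside `I`, for the weak property).
For an index `i` outside `⋂ k, A k`, let `k` be the first level with `i ∉ A k`, and let
`T i` be the `i`-th term `S k i` of a sequence of functionals attached to level `k`. If
`‖S k i‖ ≥ k + 1` for all `i`, while for each `x` the bound `‖S k i x‖ ≤ ‖x‖` holds for all but
finitely many `i`, then the indices violating `‖T i x‖ ≤ ‖x‖` form a pseudo-intersection of `A`,
hence a non-stationary set, so `T` is pointwise bounded. But the norms of `T` are at most `C` only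
outside `A C` and on the non-stationary set `⋂ k, A k`, which rules out equicontinuity
(`exists_pointwiseFBounded`).

The functionals `S k i` come from a weak Josefson–Nissenzweig theorem
(`exists_norm_ge_eventually_le`): for every `ε > 0` there are functionals `h n` with `1 ≤ ‖h n‖`
and, for each `x`, eventually `|h n x| ≤ ε * ‖x‖`. Suppose that this fails, so that every sequence
of functionals of norm at least `1` exceeds `ε` infinitely often at some point of the unit ball.

* By Riesz's lemma the dual contains a bounded separated sequence. Applying the assumption to
  differences of its terms, Galvin's lemma (`exists_infinite_homogeneous`) gives a subsequence `g`
  whose alternating sums of `2 * m` terms all have norm at least `ε * m`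
  (`DetectsNorm.exists_alternating_sum_ge`).
* Applying the assumption to normalized alternating sums, one splits each of finitely many
  subsequences of `g` into two parts by a single point of the unit ball, on average by at least
  `ε ^ 2` (`DetectsNorm.exists_split`). Iteration gives a dyadic tree of subsequences and points
  `x j` splitting its levels (`DetectsNorm.exists_tree`).
* The averages of the functionals in the tree against the `j`-th Rademacher function have limits
  `ρ j` with `ε ^ 2 / 4 ≤ ρ j (x j)`, and Bessel's inequality gives `∑ j, ρ j y ^ 2 < ∞` for every
  `y`. So `ρ j` tends to `0` pointwise but not in norm, contrary to the assumption
  (`not_detectsNorm`).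
-/

namespace FilterUBP

/-! ### Galvin's lemma -/

section Galvin

/-- `M` accepts the finite set `s`: whenever `s` is prolonged by an infinite set `N ⊆ M` lying above
`s`, some initial segment of `s ∪ N` belongs to `𝓑`. -/
def Accepts (𝓑 : Set (Finset ℕ)) (s : Finset ℕ) (M : Set ℕ) : Prop :=
  ∀ N ⊆ M, N.Infinite → (∀ a ∈ s, ∀ n ∈ N, a < n) →
    ∃ t ∈ 𝓑, ∃ k, (t : Set ℕ) = (↑s ∪ N) ∩ Set.Iio k

/-- `M` rejects the finite set `s`: no infinite subset of `M` accepts `s`. -/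
def Rejects (𝓑 : Set (Finset ℕ)) (s : Finset ℕ) (M : Set ℕ) : Prop :=
  ∀ N ⊆ M, N.Infinite → ¬ Accepts 𝓑 s N

/-- `M` decides the finite set `s` if it accepts or rejects it. -/
def Decides (𝓑 : Set (Finset ℕ)) (s : Finset ℕ) (M : Set ℕ) : Prop :=
  Accepts 𝓑 s M ∨ Rejects 𝓑 s M

variable {𝓑 : Set (Finset ℕ)} {s : Finset ℕ} {M N : Set ℕ}

lemma Accepts.mono (h : Accepts 𝓑 s M) (hN : N ⊆ M) : Accepts 𝓑 s N :=
  fun N' h' => h N' (h'.trans hN)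

lemma Rejects.mono (h : Rejects 𝓑 s M) (hN : N ⊆ M) : Rejects 𝓑 s N :=
  fun N' h' => h N' (h'.trans hN)

lemma Decides.mono (h : Decides 𝓑 s M) (hN : N ⊆ M) : Decides 𝓑 s N :=
  h.imp (·.mono hN) (·.mono hN)

lemma infinite_inter_Ioi (hM : M.Infinite) (a : ℕ) : (M ∩ Set.Ioi a).Infinite := by
  have : M \ Set.Iic a = M ∩ Set.Ioi a := by
    ext n
    simp
  exact this ▸ hM.sdiff (Set.finite_Iic a)

lemma Decides.of_inter_Ioi {a : ℕ} (ha : a ∈ s) (h : Decides 𝓑 s (M ∩ Set.Ioi a)) :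
    Decides 𝓑 s M := by
  refine h.imp (fun h N hN hinf hlt => h N (fun n hn => ⟨hN hn, hlt a ha n hn⟩) hinf hlt) ?_
  intro h N hN hinf hacc
  exact h (N ∩ Set.Ioi a) (Set.inter_subset_inter_left _ hN) (infinite_inter_Ioi hinf a)
    (hacc.mono Set.inter_subset_left)

lemma exists_subset_decides (𝓑 : Set (Finset ℕ)) (s : Finset ℕ) (hM : M.Infinite) :
    ∃ N ⊆ M, N.Infinite ∧ Decides 𝓑 s N := by
  by_cases h : ∃ N ⊆ M, N.Infinite ∧ Accepts 𝓑 s N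
  · obtain ⟨N, hN, hinf, hacc⟩ := h
    exact ⟨N, hN, hinf, .inl hacc⟩
  · push Not at h
    exact ⟨M, subset_rfl, hM, .inr h⟩

lemma exists_subset_decides_finset (𝓑 : Set (Finset ℕ)) (S : Finset (Finset ℕ))
    (hM : M.Infinite) : ∃ N ⊆ M, N.Infinite ∧ ∀ s ∈ S, Decides 𝓑 s N := by
  classical
  induction S using Finset.induction_on with
  | empty => exact ⟨M, subset_rfl, hM, by simp⟩
  | insert s S _ ih =>
    obtain ⟨N, hN, hinf, hdec⟩ := ih
    obtain ⟨N', hN', hinf', hdec'⟩ := exists_subset_decides 𝓑 s hinf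
    refine ⟨N', hN'.trans hN, hinf', fun t ht => ?_⟩
    rcases Finset.mem_insert.1 ht with rfl | ht
    · exact hdec'
    · exact (hdec t ht).mono hN'

/-- A diagonal (fusion) argument: there is an infinite set deciding all its finite subsets. -/
lemma exists_decides_all (𝓑 : Set (Finset ℕ)) :
    ∃ M : Set ℕ, M.Infinite ∧ ∀ s : Finset ℕ, ↑s ⊆ M → Decides 𝓑 s M := by
  classical
  obtain ⟨M₀, -, hM₀, hdec₀⟩ := exists_subset_decides 𝓑 ∅ (Set.infinite_univ (α := ℕ))
  have step : ∀ M : {M : Set ℕ // M.Infinite}, ∃ N : {M : Set ℕ // M.Infinite}, ∃ n ∈ M.1,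
      N.1 ⊆ M.1 ∩ Set.Ioi n ∧ ∀ s ⊆ Finset.range (n + 1), Decides 𝓑 s N.1 := by
    rintro ⟨M, hM⟩
    obtain ⟨n, hn⟩ := hM.nonempty
    obtain ⟨N, hN, hinf, hdec⟩ := exists_subset_decides_finset 𝓑 (Finset.range (n + 1)).powerset
      (infinite_inter_Ioi hM n)
    exact ⟨⟨N, hinf⟩, n, hn, hN, fun s hs => hdec s (Finset.mem_powerset.2 hs)⟩
  choose g p hp hg hdec using step
  let Q : ℕ → {M : Set ℕ // M.Infinite} := fun i => g^[i] ⟨M₀, hM₀⟩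
  have hQ : ∀ i, Q (i + 1) = g (Q i) := fun i => Function.iterate_succ_apply' _ _ _
  have hanti : Antitone fun i => (Q i).1 := antitone_nat_of_succ_le fun i => by
    rw [hQ]
    exact (hg _).trans Set.inter_subset_left
  have hmem : ∀ i j, i < j → p (Q j) ∈ (g (Q i)).1 := fun i j hij => by
    have : p (Q j) ∈ (Q (i + 1)).1 := hanti (Nat.succ_le_of_lt hij) (hp (Q j))
    rwa [hQ] at this
  have hmono : StrictMono fun i => p (Q i) :=
    strictMono_nat_of_lt_succ fun i => (hg _ (hmem i (i + 1) i.lt_succ_self)).2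
  refine ⟨Set.range fun i => p (Q i), Set.infinite_range_of_injective hmono.injective, ?_⟩
  intro s hs
  rcases s.eq_empty_or_nonempty with rfl | hne
  · refine hdec₀.mono ?_
    rintro _ ⟨i, rfl⟩
    exact hanti (Nat.zero_le i) (hp (Q i))
  · obtain ⟨i, hi : p (Q i) = _⟩ := hs (s.max'_mem hne)
    refine Decides.of_inter_Ioi (s.max'_mem hne) ((hdec (Q i) s fun a ha => ?_).mono ?_)
    · rw [Finset.mem_range, hi]
      exact Nat.lt_succ_of_le (s.le_max' a ha)
    · rintro _ ⟨⟨j, rfl⟩, hj⟩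
      rw [← hi] at hj
      exact hmem i j (hmono.lt_iff_lt.1 hj)

/-- If `M` rejects `s`, then `M` accepts only finitely many one-point prolongations of `s`: an
infinite set of accepted prolongations would itself accept `s`. -/
lemma Rejects.finite_accepts_insert (h : Rejects 𝓑 s M) :
    {n ∈ M | Accepts 𝓑 (insert n s) M}.Finite := by
  by_contra hinf
  refine h _ (Set.sep_subset _ _) hinf fun N hN hNinf hlt => ?_
  have hm : sInf N ∈ N := Nat.sInf_mem hNinf.nonempty
  obtain ⟨t, ht, k, hk⟩ := (hN hm).2 (N ∩ Set.Ioi (sInf N)) (fun n hn => (hN hn.1).1)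
    (infinite_inter_Ioi hNinf _) (by
      intro a ha n hn
      rcases Finset.mem_insert.1 ha with rfl | ha
      · exact hn.2
      · exact hlt a ha n hn.1)
  refine ⟨t, ht, k, hk.trans ?_⟩
  congr 1
  ext n
  simp only [Finset.coe_insert, Set.mem_union, Set.mem_insert_iff, Finset.mem_coe, Set.mem_inter_iff,
    Set.mem_Ioi]
  constructor
  · rintro ((rfl | h) | h)
    exacts [.inr hm, .inl h, .inr h.1]
  · rintro (h | h)
    · exact .inl (.inr h)
    · rcases (Nat.sInf_le h).eq_or_lt with h' | h'
      exacts [.inl (.inl h'.symm), .inr ⟨h, h'⟩]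

lemma accepts_of_mem (hs : s ∈ 𝓑) : Accepts 𝓑 s M := by
  intro N _ _ hlt
  refine ⟨s, hs, s.sup (· + 1), ?_⟩
  ext n
  simp only [Finset.mem_coe, Set.mem_inter_iff, Set.mem_union, Set.mem_Iio]
  constructor
  · intro hn
    exact ⟨.inl hn, Nat.lt_of_succ_le (Finset.le_sup (f := (· + 1)) hn)⟩
  · rintro ⟨hn | hn, hlt'⟩
    · exact hn
    · exact absurd hlt' (not_lt.2 (Finset.sup_le fun a ha => hlt a ha n hn))

/-- Galvin's lemma, the Ramsey theorem for open sets of infinite subsets of `ℕ`: for every family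
`𝓑` of finite sets there is an infinite `M` such that either no finite subset of `M` belongs to
`𝓑`, or every infinite subset of `M` has an initial segment in `𝓑`. -/
theorem exists_infinite_homogeneous (𝓑 : Set (Finset ℕ)) :
    ∃ M : Set ℕ, M.Infinite ∧ ((∀ s : Finset ℕ, ↑s ⊆ M → s ∉ 𝓑) ∨
      ∀ N ⊆ M, N.Infinite → ∃ t ∈ 𝓑, ∃ k, (t : Set ℕ) = N ∩ Set.Iio k) := by
  classical
  obtain ⟨M, hM, hdec⟩ := exists_decides_all 𝓑
  rcases hdec ∅ (by simp) with hacc | hrej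
  · refine ⟨M, hM, .inr fun N hN hinf => ?_⟩
    simpa using hacc N hN hinf (by simp)
  have step : ∀ t : {t : Finset ℕ // ↑t ⊆ M ∧ ∀ s ⊆ t, Rejects 𝓑 s M},
      ∃ t' : {t : Finset ℕ // ↑t ⊆ M ∧ ∀ s ⊆ t, Rejects 𝓑 s M}, t.1 ⊂ t'.1 := by
    rintro ⟨t, htM, ht⟩
    have hfin : ((t : Set ℕ) ∪ ⋃ s ∈ t.powerset,
        {n ∈ M | Accepts 𝓑 (insert n s) M}).Finite :=
      t.finite_toSet.union <| t.powerset.finite_toSet.biUnion fun s hs =>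
        (ht s (Finset.mem_powerset.1 hs)).finite_accepts_insert
    obtain ⟨n, hnM, hn⟩ := (hM.sdiff hfin).nonempty
    simp only [Set.mem_union, Set.mem_iUnion, not_or, not_exists] at hn
    have hsub : ↑(insert n t) ⊆ M := by
      rw [Finset.coe_insert]
      exact Set.insert_subset hnM htM
    refine ⟨⟨insert n t, hsub, fun s hs => ?_⟩, Finset.ssubset_insert hn.1⟩
    by_cases hns : n ∈ s
    · refine (hdec s ((Finset.coe_subset.2 hs).trans hsub)).resolve_left fun hacc => ?_
      refine hn.2 (s.erase n) (Finset.mem_powerset.2 ?_) ⟨hnM, ?_⟩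
      · rwa [← Finset.subset_insert_iff]
      · rwa [Finset.insert_erase hns]
    · exact ht s ((Finset.subset_insert_iff_of_notMem hns).1 hs)
  choose g hg using step
  let Q : ℕ → {t : Finset ℕ // ↑t ⊆ M ∧ ∀ s ⊆ t, Rejects 𝓑 s M} := fun i =>
    g^[i] ⟨∅, by simp, fun s hs => by rwa [Finset.subset_empty.1 hs]⟩
  have hmono : StrictMono fun i => (Q i).1 := strictMono_nat_of_lt_succ fun i => by
    have : Q (i + 1) = g (Q i) := Function.iterate_succ_apply' _ _ _
    rw [this]
    exact hg _
  have hsub : ∀ s : Finset ℕ, (s : Set ℕ) ⊆ ⋃ i, ((Q i).1 : Set ℕ) → ∃ i, s ⊆ (Q i).1 := by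
    intro s
    induction s using Finset.induction_on with
    | empty => exact fun _ => ⟨0, by simp⟩
    | insert a s _ ih =>
      intro h
      rw [Finset.coe_insert, Set.insert_subset_iff] at h
      obtain ⟨i, hi⟩ := ih h.2
      obtain ⟨j, hj⟩ := Set.mem_iUnion.1 h.1
      exact ⟨max i j, Finset.insert_subset (hmono.monotone (le_max_right i j) hj)
        (hi.trans (hmono.monotone (le_max_left i j)))⟩
  refine ⟨⋃ i, ((Q i).1 : Set ℕ), fun hfin => ?_, .inl fun s hs hs𝓑 => ?_⟩
  · obtain ⟨i, hi⟩ := hsub hfin.toFinset (by simp)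
    refine (hmono i.lt_succ_self).not_ge (le_trans (fun a ha => ?_) hi)
    simpa using ⟨_, ha⟩
  · obtain ⟨i, hi⟩ := hsub s hs
    exact (Q i).2.2 s hi M subset_rfl hM (accepts_of_mem hs𝓑)

end Galvin

end FilterUBP

namespace FilterUBP

open Filter Topology

/-! ### A weak Josefson–Nissenzweig theorem -/

section JosefsonNissenzweig

variable {E : Type*} [NormedAddCommGroup E] [NormedSpace ℝ E]

/-- The unit ball of `E` detects norms up to `ε`: no sequence of functionals of norm at least `1`
is eventually bounded by `ε` at each point of the unit ball. -/
def DetectsNorm (E : Type*) [NormedAddCommGroup E] [NormedSpace ℝ E] (ε : ℝ) : Prop :=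
  ∀ h : ℕ → StrongDual ℝ E, (∀ n, 1 ≤ ‖h n‖) → ∃ x : E, ‖x‖ ≤ 1 ∧ ∃ᶠ n in atTop, ε < |h n x|

/-- In the definition of `DetectsNorm` one may pass to a subsequence and drop the absolute value,
replacing `x` by `-x` if necessary. -/
lemma DetectsNorm.exists_subseq {ε : ℝ} (H : DetectsNorm E ε) {h : ℕ → StrongDual ℝ E}
    (hh : ∀ n, 1 ≤ ‖h n‖) :
    ∃ x : E, ‖x‖ ≤ 1 ∧ ∃ ψ : ℕ → ℕ, StrictMono ψ ∧ ∀ n, ε < h (ψ n) x := by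
  obtain ⟨x, hx, hfreq⟩ := H h hh
  have : ∃ᶠ n in atTop, ε < h n x ∨ ε < h n (-x) := hfreq.mono fun n hn => by
    simpa [lt_abs] using hn
  rcases frequently_or_distrib.1 this with h | h
  · exact ⟨x, hx, extraction_of_frequently_atTop h⟩
  · exact ⟨-x, by rwa [norm_neg], extraction_of_frequently_atTop h⟩

/-- If the image of `range a` under a strictly increasing `u` is an initial segment of the range
of a strictly increasing `w`, then `u` and `w` agree on `range a`. -/
lemma eq_of_image_range_eq_range_inter_Iio {u w : ℕ → ℕ} (hu : StrictMono u) (hw : StrictMono w)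
    {a k : ℕ} (h : (((Finset.range a).image u : Finset ℕ) : Set ℕ) = Set.range w ∩ Set.Iio k) :
    ∀ i < a, u i = w i := by
  set t := (Finset.range a).image u with ht
  have hcard : t.card = a := by
    rw [ht, Finset.card_image_of_injective _ hu.injective, Finset.card_range]
  have hmem : ∀ n, n ∈ t ↔ n ∈ Set.range w ∧ n < k := fun n => by
    rw [← Finset.mem_coe, h]; rfl
  have hwt : ∀ i < a, w i ∈ t := by
    intro i hi
    refine (hmem _).2 ⟨⟨i, rfl⟩, ?_⟩
    by_contra! hk
    have hsub : t ⊆ (Finset.range i).image w := by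
      intro n hn
      obtain ⟨⟨l, rfl⟩, hl⟩ := (hmem n).1 hn
      exact Finset.mem_image_of_mem _ (Finset.mem_range.2 (hw.lt_iff_lt.1 (hl.trans_le hk)))
    have := (Finset.card_le_card hsub).trans Finset.card_image_le
    rw [hcard, Finset.card_range] at this
    omega
  have h1 := Finset.orderEmbOfFin_unique hcard (f := fun i : Fin a => u i)
    (fun i => Finset.mem_image_of_mem _ (Finset.mem_range.2 i.2)) fun i j hij => hu hij
  have h2 := Finset.orderEmbOfFin_unique hcard (f := fun i : Fin a => w i)
    (fun i => hwt i i.2) fun i j hij => hw hij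
  intro i hi
  exact congrFun (h1.trans h2.symm) ⟨i, hi⟩

/-- A norm-separated sequence of functionals has a subsequence all of whose alternating sums are as
large as in `ℓ¹`. By Galvin's lemma, otherwise every subsequence of some subsequence would start
with a small alternating sum; this fails for the subsequence along which a point detecting the
differences of consecutive terms makes all these differences larger than `ε`. -/
lemma DetectsNorm.exists_alternating_sum_ge {ε : ℝ} (H : DetectsNorm E ε)
    {f : ℕ → StrongDual ℝ E} (hf : Pairwise fun m n => 1 ≤ ‖f m - f n‖) :
    ∃ φ : ℕ → ℕ, ∀ u : ℕ → ℕ, StrictMono u → ∀ m : ℕ,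
      ε * m ≤ ‖∑ s ∈ Finset.range m, (f (φ (u (2 * s))) - f (φ (u (2 * s + 1))))‖ := by
  classical
  let 𝓑 : Set (Finset ℕ) := {t | ∃ u : ℕ → ℕ, StrictMono u ∧ ∃ m : ℕ,
    t = (Finset.range (2 * m)).image u ∧
      ‖∑ s ∈ Finset.range m, (f (u (2 * s)) - f (u (2 * s + 1)))‖ < ε * m}
  obtain ⟨M, hM, hhom⟩ := exists_infinite_homogeneous 𝓑
  have hφ : StrictMono (Nat.nth (· ∈ M)) := Nat.nth_strictMono hM
  have hφM : ∀ i, Nat.nth (· ∈ M) i ∈ M := Nat.nth_mem_of_infinite hM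
  set φ := Nat.nth (· ∈ M)
  refine ⟨φ, ?_⟩
  rcases hhom with hgood | hbad
  · intro u hu m
    by_contra! hlt
    refine hgood ((Finset.range (2 * m)).image (φ ∘ u)) ?_ ⟨φ ∘ u, hφ.comp hu, m, rfl, hlt⟩
    intro n hn
    obtain ⟨i, -, rfl⟩ := Finset.mem_image.1 hn
    exact hφM _
  · exfalso
    obtain ⟨x, hx, ψ, hψ, hlt⟩ := H.exists_subseq
      (h := fun j => f (φ (2 * j)) - f (φ (2 * j + 1)))
      fun j => hf (hφ.injective.ne (by omega))
    let w : ℕ → ℕ := fun i => φ (2 * ψ (i / 2) + i % 2)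
    have hw : StrictMono w := strictMono_nat_of_lt_succ fun i => hφ (by
      rcases Nat.even_or_odd' i with ⟨c, rfl | rfl⟩
      · have h1 : (2 * c + 1) / 2 = c := by omega
        have h2 : 2 * c / 2 = c := by omega
        rw [h1, h2]; omega
      · have h1 : (2 * c + 1 + 1) / 2 = c + 1 := by omega
        have h2 : (2 * c + 1) / 2 = c := by omega
        have := hψ (Nat.lt_add_one c)
        rw [h1, h2]; omega)
    obtain ⟨t, ⟨u, hu, m, rfl, hsmall⟩, k, hk⟩ := hbad (Set.range w)
      (by rintro _ ⟨i, rfl⟩; exact hφM _) (Set.infinite_range_of_injective hw.injective)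
    have huw := eq_of_image_range_eq_range_inter_Iio hu hw hk
    refine hsmall.not_ge ?_
    calc ε * m = ∑ s ∈ Finset.range m, ε := by simp [mul_comm]
      _ ≤ ∑ s ∈ Finset.range m, (f (u (2 * s)) - f (u (2 * s + 1))) x := by
        refine Finset.sum_le_sum fun s hs => ?_
        have hs := Finset.mem_range.1 hs
        rw [huw _ (by omega), huw _ (by omega)]
        have h1 : (2 * s + 1) / 2 = s := by omega
        have h2 : 2 * s / 2 = s := by omega
        have h3 : (2 * s + 1) % 2 = 1 := by omega
        have h4 : 2 * s % 2 = 0 := by omega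
        simp only [w, h1, h2, h3, h4, add_zero]
        exact (hlt s).le
      _ = (∑ s ∈ Finset.range m, (f (u (2 * s)) - f (u (2 * s + 1)))) x := by
        rw [sum_apply]
      _ ≤ _ := (le_abs_self _).trans (((∑ s ∈ Finset.range m,
        (f (u (2 * s)) - f (u (2 * s + 1)))) : StrongDual ℝ E).unit_le_opNorm x hx)

/-- One step of the tree construction: `m` subsequences of `g`, given by `ν s` for `s < m`, are
split simultaneously by one point `x` of the unit ball. The limits `a s`, `b s` of `g · x` along the
two parts of the `s`-th subsequence differ by at least `ε ^ 2` on average. -/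
lemma DetectsNorm.exists_split {ε R : ℝ} (hε : 0 < ε) (H : DetectsNorm E ε)
    {g : ℕ → StrongDual ℝ E} (hR : ∀ n, ‖g n‖ ≤ R)
    (hg : ∀ u : ℕ → ℕ, StrictMono u → ∀ m : ℕ,
      ε * m ≤ ‖∑ s ∈ Finset.range m, (g (u (2 * s)) - g (u (2 * s + 1)))‖)
    {m : ℕ} (hm : 0 < m) {ν : ℕ → ℕ → ℕ} (hν : ∀ s, Tendsto (ν s) atTop atTop) :
    ∃ x : E, ‖x‖ ≤ 1 ∧ ∃ p q : ℕ → ℕ → ℕ, (∀ s, Tendsto (p s) atTop atTop) ∧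
      (∀ s, Tendsto (q s) atTop atTop) ∧ ∃ a b : ℕ → ℝ,
      (∀ s, Tendsto (fun l => g (ν s (p s l)) x) atTop (𝓝 (a s))) ∧
      (∀ s, Tendsto (fun l => g (ν s (q s l)) x) atTop (𝓝 (b s))) ∧
      ε ^ 2 * m ≤ ∑ s ∈ Finset.range m, (a s - b s) := by
  have hnext : ∀ l i n : ℕ, ∃ c, l ≤ c ∧ n < ν (i / 2) c := fun l i n =>
    ((eventually_ge_atTop l).and ((hν (i / 2)).eventually_gt_atTop n)).exists
  choose c hc hcn using hnext
  -- `π l` lists positions beyond `l` along which the `ν (i / 2)` interlace in increasing order.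
  let π : ℕ → ℕ → ℕ := fun l i => Nat.rec (c l 0 0) (fun i r => c l (i + 1) (ν (i / 2) r)) i
  have hπ : ∀ l i, l ≤ π l i := fun l i => by
    cases i with
    | zero => exact hc _ _ _
    | succ i => exact hc _ _ _
  let u : ℕ → ℕ → ℕ := fun l i => ν (i / 2) (π l i)
  have hu : ∀ l, StrictMono (u l) := fun l => strictMono_nat_of_lt_succ fun i => hcn _ _ _
  have hm' : (0 : ℝ) < ε * m := by positivity
  let S : ℕ → StrongDual ℝ E := fun l =>
    ∑ s ∈ Finset.range m, (g (u l (2 * s)) - g (u l (2 * s + 1)))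
  obtain ⟨x, hx, ψ, hψ, hlt⟩ := H.exists_subseq (h := fun l => (ε * m)⁻¹ • S l) fun l => by
    rw [norm_smul, norm_inv, Real.norm_of_nonneg hm'.le, ← div_eq_inv_mul, one_le_div hm']
    exact hg _ (hu l) m
  have hbd : ∀ l, (fun i => g (u (ψ l) i) x) ∈ Set.univ.pi fun _ : ℕ => Set.Icc (-R) R :=
    fun l i _ => abs_le.1 <|
      (ContinuousLinearMap.unit_le_opNorm (g (u (ψ l) i)) x hx).trans (hR _)
  obtain ⟨v, -, θ, hθ, hlim⟩ :=
    (isCompact_univ_pi fun _ : ℕ => isCompact_Icc (a := -R) (b := R)).tendsto_subseq hbd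
  rw [tendsto_pi_nhds] at hlim
  have htends : ∀ i, Tendsto (fun l => π (ψ (θ l)) i) atTop atTop := fun i =>
    tendsto_atTop_mono (fun l => hπ _ _) (hψ.comp hθ).tendsto_atTop
  have h0 : ∀ s, 2 * s / 2 = s := fun s => by omega
  have h1 : ∀ s, (2 * s + 1) / 2 = s := fun s => by omega
  refine ⟨x, hx, fun s l => π (ψ (θ l)) (2 * s), fun s l => π (ψ (θ l)) (2 * s + 1),
    fun s => htends (2 * s), fun s => htends (2 * s + 1), fun s => v (2 * s), fun s => v (2 * s + 1),
    fun s => ?_, fun s => ?_, ?_⟩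
  · simpa [u, h0, Function.comp_def] using hlim (2 * s)
  · simpa [u, h1, Function.comp_def] using hlim (2 * s + 1)
  · refine ge_of_tendsto' (tendsto_finsetSum (Finset.range m) fun s _ =>
      (hlim (2 * s)).sub (hlim (2 * s + 1))) fun l => ?_
    have := hlt (θ l)
    rw [smul_apply, smul_eq_mul, ← div_eq_inv_mul, lt_div_iff₀ hm'] at this
    simp only [S, sum_apply, sub_apply] at this
    simp only [Function.comp_apply]
    linarith

/-- The `j`-th Rademacher function: the sign `±1` given by the `j`-th binary digit. -/
def rademacher (j s : ℕ) : ℝ := if s.testBit j then 1 else -1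

lemma abs_rademacher (j s : ℕ) : |rademacher j s| = 1 := by
  unfold rademacher
  split_ifs <;> simp

lemma rademacher_two_pow_add {j k : ℕ} (h : j < k) (s : ℕ) :
    rademacher j (2 ^ k + s) = rademacher j s := by
  unfold rademacher
  rw [Nat.testBit_two_pow_add_gt h]

lemma rademacher_of_lt {k s : ℕ} (h : s < 2 ^ k) : rademacher k s = -1 := by
  simp [rademacher, Nat.testBit_lt_two_pow h]

lemma rademacher_two_pow_add_self {k s : ℕ} (h : s < 2 ^ k) : rademacher k (2 ^ k + s) = 1 := by
  simp [rademacher, Nat.testBit_two_pow_add_eq, Nat.testBit_lt_two_pow h]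

lemma sum_range_two_pow_succ (k : ℕ) (y : ℕ → ℝ) :
    ∑ s ∈ Finset.range (2 ^ (k + 1)), y s
      = ∑ s ∈ Finset.range (2 ^ k), (y s + y (2 ^ k + s)) := by
  rw [pow_succ, mul_two, Finset.sum_range_add, Finset.sum_add_distrib]

/-- Bessel's inequality for the Rademacher functions. -/
lemma sum_sq_rademacher_le (k : ℕ) (y : ℕ → ℝ) :
    ∑ j ∈ Finset.range k, (∑ s ∈ Finset.range (2 ^ k), rademacher j s * y s) ^ 2
      ≤ 2 ^ k * ∑ s ∈ Finset.range (2 ^ k), y s ^ 2 := by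
  induction k generalizing y with
  | zero => simpa using sq_nonneg _
  | succ k ih =>
    have hlow : ∀ j ∈ Finset.range k,
        (∑ s ∈ Finset.range (2 ^ (k + 1)), rademacher j s * y s) ^ 2
          = (∑ s ∈ Finset.range (2 ^ k), rademacher j s * (y s + y (2 ^ k + s))) ^ 2 := by
      intro j hj
      rw [sum_range_two_pow_succ]
      congr 1
      refine Finset.sum_congr rfl fun s _ => ?_
      rw [rademacher_two_pow_add (Finset.mem_range.1 hj)]
      ring
    have htop : ∑ s ∈ Finset.range (2 ^ (k + 1)), rademacher k s * y s
        = ∑ s ∈ Finset.range (2 ^ k), (y (2 ^ k + s) - y s) := by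
      rw [sum_range_two_pow_succ]
      refine Finset.sum_congr rfl fun s hs => ?_
      rw [rademacher_of_lt (Finset.mem_range.1 hs),
        rademacher_two_pow_add_self (Finset.mem_range.1 hs)]
      ring
    have hcs : (∑ s ∈ Finset.range (2 ^ k), (y (2 ^ k + s) - y s)) ^ 2
        ≤ 2 ^ k * ∑ s ∈ Finset.range (2 ^ k), (y (2 ^ k + s) - y s) ^ 2 := by
      simpa using sq_sum_le_card_mul_sum_sq (s := Finset.range (2 ^ k))
        (f := fun s => y (2 ^ k + s) - y s)
    rw [Finset.sum_range_succ, Finset.sum_congr rfl hlow, htop]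
    refine (add_le_add (ih _) hcs).trans_eq ?_
    rw [sum_range_two_pow_succ, pow_succ, mul_assoc, ← mul_add, ← Finset.sum_add_distrib,
      Finset.mul_sum _ _ (2 : ℝ)]
    congr 1
    refine Finset.sum_congr rfl fun s _ => ?_
    ring

/-- The tree construction: points `x j` of the unit ball and, at each level `k`, functionals
`g (N k s)` indexed by `s < 2 ^ k` whose values at `x j`, for `j < k`, are correlated with the
`j`-th Rademacher function. -/
lemma DetectsNorm.exists_tree {ε R : ℝ} (hε : 0 < ε) (H : DetectsNorm E ε)
    {g : ℕ → StrongDual ℝ E} (hR : ∀ n, ‖g n‖ ≤ R)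
    (hg : ∀ u : ℕ → ℕ, StrictMono u → ∀ m : ℕ,
      ε * m ≤ ‖∑ s ∈ Finset.range m, (g (u (2 * s)) - g (u (2 * s + 1)))‖) :
    ∃ (x : ℕ → E) (N : ℕ → ℕ → ℕ), (∀ j, ‖x j‖ ≤ 1) ∧ ∀ k, ∀ j < k,
      ε ^ 2 / 4 * 2 ^ k ≤ ∑ s ∈ Finset.range (2 ^ k), rademacher j s * g (N k s) (x j) := by
  have step : ∀ (k : ℕ) (ν : {ν : ℕ → ℕ → ℕ // ∀ s, Tendsto (ν s) atTop atTop}),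
      ∃ (ν' : {ν : ℕ → ℕ → ℕ // ∀ s, Tendsto (ν s) atTop atTop}) (x : E), ‖x‖ ≤ 1 ∧
        (∀ s < 2 ^ k, ∃ q : ℕ → ℕ, Tendsto q atTop atTop ∧ ν'.1 s = ν.1 s ∘ q) ∧
        (∀ s < 2 ^ k, ∃ p : ℕ → ℕ, Tendsto p atTop atTop ∧ ν'.1 (2 ^ k + s) = ν.1 s ∘ p) ∧
        ∃ v : ℕ → ℝ,
          (∀ s < 2 ^ (k + 1), Tendsto (fun l => g (ν'.1 s l) x) atTop (𝓝 (v s))) ∧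
          ε ^ 2 / 2 * 2 ^ (k + 1) ≤ ∑ s ∈ Finset.range (2 ^ (k + 1)), rademacher k s * v s := by
    rintro k ⟨ν, hν⟩
    obtain ⟨x, hx, p, q, hp, hq, a, b, ha, hb, hab⟩ :=
      H.exists_split hε hR hg (m := 2 ^ k) (by positivity) hν
    refine ⟨⟨fun s => if s < 2 ^ k then ν s ∘ q s else ν (s - 2 ^ k) ∘ p (s - 2 ^ k), ?_⟩,
      x, hx, ?_, ?_, fun s => if s < 2 ^ k then b s else a (s - 2 ^ k), ?_, ?_⟩
    · intro s
      dsimp only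
      split_ifs
      exacts [(hν _).comp (hq _), (hν _).comp (hp _)]
    · exact fun s hs => ⟨q s, hq s, by simp [hs]⟩
    · exact fun s hs => ⟨p s, hp s, by simp⟩
    · intro s _
      dsimp only
      split_ifs
      exacts [hb _, ha _]
    · rw [sum_range_two_pow_succ]
      have : ∑ s ∈ Finset.range (2 ^ k),
          (rademacher k s * (if s < 2 ^ k then b s else a (s - 2 ^ k)) +
            rademacher k (2 ^ k + s) *
              (if 2 ^ k + s < 2 ^ k then b (2 ^ k + s) else a (2 ^ k + s - 2 ^ k)))
          = ∑ s ∈ Finset.range (2 ^ k), (a s - b s) := by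
        refine Finset.sum_congr rfl fun s hs => ?_
        have hs := Finset.mem_range.1 hs
        rw [rademacher_of_lt hs, rademacher_two_pow_add_self hs]
        simp [hs]
        ring
      rw [this]
      push_cast at hab
      rw [pow_succ (2 : ℝ) k]
      linarith
  choose next x hx hq hp v hv hvsum using step
  let Q : ℕ → {ν : ℕ → ℕ → ℕ // ∀ s, Tendsto (ν s) atTop atTop} := fun k =>
    Nat.rec ⟨fun _ => id, fun _ => tendsto_id⟩ (fun k ν => next k ν) k
  have hQ : ∀ k, Q (k + 1) = next k (Q k) := fun _ => rfl
  have hinv : ∀ k, ∀ j < k, ∃ v : ℕ → ℝ,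
      (∀ s < 2 ^ k, Tendsto (fun l => g ((Q k).1 s l) (x j (Q j))) atTop (𝓝 (v s))) ∧
      ε ^ 2 / 2 * 2 ^ k ≤ ∑ s ∈ Finset.range (2 ^ k), rademacher j s * v s := by
    intro k
    induction k with
    | zero => exact fun j hj => absurd hj (Nat.not_lt_zero j)
    | succ k ih =>
      intro j hj
      rcases Nat.lt_succ_iff_lt_or_eq.1 hj with hj | rfl
      · obtain ⟨w, hw, hsum⟩ := ih j hj
        refine ⟨fun s => if s < 2 ^ k then w s else w (s - 2 ^ k), fun s hs => ?_, ?_⟩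
        · by_cases hsk : s < 2 ^ k
          · obtain ⟨q, hq, heq⟩ := hq k (Q k) s hsk
            simp only [hQ, heq, hsk, if_true]
            exact (hw s hsk).comp hq
          · obtain ⟨s, rfl⟩ := Nat.exists_eq_add_of_le (not_lt.1 hsk)
            have hsk : s < 2 ^ k := by rw [pow_succ] at hs; omega
            obtain ⟨p, hp, heq⟩ := hp k (Q k) s hsk
            simp only [hQ, heq, if_false, Nat.not_lt.2 (Nat.le_add_right _ _),
              Nat.add_sub_cancel_left]
            exact (hw s hsk).comp hp
        · rw [sum_range_two_pow_succ]
          have : ∑ s ∈ Finset.range (2 ^ k),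
              (rademacher j s * (if s < 2 ^ k then w s else w (s - 2 ^ k)) +
                rademacher j (2 ^ k + s) *
                  (if 2 ^ k + s < 2 ^ k then w (2 ^ k + s) else w (2 ^ k + s - 2 ^ k)))
              = 2 * ∑ s ∈ Finset.range (2 ^ k), rademacher j s * w s := by
            rw [Finset.mul_sum]
            refine Finset.sum_congr rfl fun s hs => ?_
            rw [rademacher_two_pow_add hj]
            simp [Finset.mem_range.1 hs]
            ring
          rw [this, pow_succ (2 : ℝ) k]
          linarith
      · exact ⟨v j (Q j), hv j (Q j), hvsum j (Q j)⟩
  -- Far out along the subsequences of level `k`, half of each lower bound survives.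
  have hfin : ∀ k, ∃ l, ∀ j < k, ε ^ 2 / 4 * 2 ^ k
      ≤ ∑ s ∈ Finset.range (2 ^ k), rademacher j s * g ((Q k).1 s l) (x j (Q j)) := by
    intro k
    have : ∀ j ∈ Finset.range k, ∀ᶠ l in atTop, ε ^ 2 / 4 * 2 ^ k
        ≤ ∑ s ∈ Finset.range (2 ^ k), rademacher j s * g ((Q k).1 s l) (x j (Q j)) := by
      intro j hj
      obtain ⟨w, hw, hsum⟩ := hinv k j (Finset.mem_range.1 hj)
      have hlim : Tendsto (fun l => ∑ s ∈ Finset.range (2 ^ k),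
          rademacher j s * g ((Q k).1 s l) (x j (Q j))) atTop
          (𝓝 (∑ s ∈ Finset.range (2 ^ k), rademacher j s * w s)) :=
        tendsto_finsetSum _ fun s hs => (hw s (Finset.mem_range.1 hs)).const_mul _
      refine (hlim.eventually_const_lt (lt_of_lt_of_le ?_ hsum)).mono fun l hl => hl.le
      gcongr
      norm_num
    obtain ⟨l, hl⟩ := ((Finset.range k).eventually_all.2 this).exists
    exact ⟨l, fun j hj => hl j (Finset.mem_range.2 hj)⟩
  choose l hl using hfin
  exact ⟨fun j => x j (Q j), fun k s => (Q k).1 s (l k), fun j => hx _ _, hl⟩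

/-- By the Banach–Alaoglu theorem, a bounded sequence of functionals converges pointwise along a
nonprincipal ultrafilter. -/
lemma exists_tendsto_hyperfilter {R : ℝ} {r : ℕ → StrongDual ℝ E} (hr : ∀ k, ‖r k‖ ≤ R) :
    ∃ ρ : StrongDual ℝ E, ∀ x, Tendsto (fun k => r k x) (hyperfilter ℕ) (𝓝 (ρ x)) := by
  obtain ⟨ρ, -, hρ⟩ := (WeakDual.isCompact_closedBall (𝕜 := ℝ)
    (0 : StrongDual ℝ E) R).ultrafilter_le_nhds
    ((hyperfilter ℕ).map fun k => StrongDual.toWeakDual (r k)) (by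
      rw [Ultrafilter.coe_map, le_principal_iff, mem_map]
      refine univ_mem' fun k => ?_
      simpa using hr k)
  refine ⟨WeakDual.toStrongDual ρ, fun x => ?_⟩
  exact ((WeakDual.eval_continuous x).tendsto ρ).comp (tendsto_map'_iff.1 hρ)

/-- In an infinite-dimensional space the unit ball does not detect norms, even up to a small
constant. Otherwise the Rademacher averages of the functionals in the tree have limits `ρ j` that
are square-summable at every point, hence tend to `0` pointwise, while `ρ j (x j)` stays away
from `0`. -/
theorem not_detectsNorm (hE : ¬ FiniteDimensional ℝ E) {ε : ℝ} (hε : 0 < ε) :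
    ¬ DetectsNorm E ε := by
  intro H
  have hdual : ¬ FiniteDimensional ℝ (StrongDual ℝ E) := by
    intro h
    refine hE (FiniteDimensional.of_injective
      (NormedSpace.inclusionInDoubleDualLi ℝ (E := E)).toLinearMap
      (NormedSpace.inclusionInDoubleDualLi ℝ (E := E)).injective)
  obtain ⟨R, f, -, hR, hsep⟩ := exists_seq_norm_le_one_le_norm_sub (𝕜 := ℝ) hdual
  obtain ⟨φ, hφ⟩ := H.exists_alternating_sum_ge hsep
  obtain ⟨x, N, hx, hN⟩ := H.exists_tree hε (g := fun n => f (φ n)) (fun n => hR _) hφ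
  let r : ℕ → ℕ → StrongDual ℝ E := fun j k =>
    ((2 : ℝ) ^ k)⁻¹ • ∑ s ∈ Finset.range (2 ^ k), rademacher j s • f (φ (N k s))
  have hr : ∀ j k, ‖r j k‖ ≤ R := by
    intro j k
    rw [norm_smul, norm_inv, norm_pow, Real.norm_ofNat, inv_mul_le_iff₀ (by positivity)]
    refine (norm_sum_le_of_le (Finset.range (2 ^ k)) (f := fun s => rademacher j s • f (φ (N k s)))
      (n := fun _ => R) fun s _ => ?_).trans_eq (by simp)
    rw [norm_smul, Real.norm_eq_abs, abs_rademacher, one_mul]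
    exact hR _
  have happly : ∀ j k y, r j k y
      = ((2 : ℝ) ^ k)⁻¹ * ∑ s ∈ Finset.range (2 ^ k), rademacher j s * f (φ (N k s)) y := by
    intro j k y
    simp [r]
  choose ρ hρ using fun j => exists_tendsto_hyperfilter (hr j)
  have hcof : (hyperfilter ℕ : Filter ℕ) ≤ atTop := Nat.hyperfilter_le_atTop
  have hbessel : ∀ y J, ∑ j ∈ Finset.range J, ρ j y ^ 2 ≤ (R * ‖y‖) ^ 2 := by
    intro y J
    refine le_of_tendsto (tendsto_finsetSum _ fun j _ => (hρ j y).pow 2)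
      ?_
    filter_upwards [hcof (eventually_ge_atTop J)] with k hk
    have hy : ∀ s, f (φ (N k s)) y ^ 2 ≤ (R * ‖y‖) ^ 2 := fun s => by
      rw [← sq_abs]
      gcongr
      exact (f _).le_of_opNorm_le (hR _) y
    calc ∑ j ∈ Finset.range J, r j k y ^ 2
        ≤ ∑ j ∈ Finset.range k, r j k y ^ 2 :=
          Finset.sum_le_sum_of_subset_of_nonneg (Finset.range_mono hk) fun _ _ _ => sq_nonneg _
      _ = (((2 : ℝ) ^ k)⁻¹) ^ 2 * ∑ j ∈ Finset.range k,
            (∑ s ∈ Finset.range (2 ^ k), rademacher j s * f (φ (N k s)) y) ^ 2 := by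
          simp_rw [happly, mul_pow, Finset.mul_sum]
      _ ≤ (((2 : ℝ) ^ k)⁻¹) ^ 2 * (2 ^ k * ∑ s ∈ Finset.range (2 ^ k), (R * ‖y‖) ^ 2) := by
          gcongr
          refine (sum_sq_rademacher_le k _).trans ?_
          exact mul_le_mul_of_nonneg_left (Finset.sum_le_sum fun s _ => hy s) (by positivity)
      _ = (R * ‖y‖) ^ 2 := by
          rw [Finset.sum_const, Finset.card_range, nsmul_eq_mul]
          push_cast
          field_simp
  have hzero : ∀ y, Tendsto (fun j => ρ j y) atTop (𝓝 0) := by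
    intro y
    have hsum : Summable fun j => ρ j y ^ 2 :=
      summable_of_sum_range_le (fun _ => sq_nonneg _) (hbessel y)
    have := hsum.tendsto_atTop_zero.sqrt
    simp only [Real.sqrt_sq_eq_abs, Real.sqrt_zero] at this
    exact (tendsto_zero_iff_abs_tendsto_zero _).2 this
  have hlow : ∀ j, ε ^ 2 / 4 ≤ ‖ρ j‖ := by
    intro j
    have : ε ^ 2 / 4 ≤ ρ j (x j) := by
      refine ge_of_tendsto (hρ j (x j)) ?_
      filter_upwards [hcof (eventually_gt_atTop j)] with k hk
      rw [happly, ← div_eq_inv_mul, le_div_iff₀ (by positivity)]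
      exact hN k j hk
    exact this.trans ((le_abs_self _).trans ((ρ j).unit_le_opNorm _ (hx j)))
  have hc : 0 < ε ^ 2 / 4 := by positivity
  obtain ⟨y, -, hfreq⟩ := H (fun j => (ε ^ 2 / 4)⁻¹ • ρ j) fun j => by
    rw [norm_smul, norm_inv, Real.norm_of_nonneg hc.le, ← div_eq_inv_mul, one_le_div hc]
    exact hlow j
  have hlim : Tendsto (fun j => |((ε ^ 2 / 4)⁻¹ • ρ j) y|) atTop (𝓝 0) := by
    have := ((hzero y).const_mul (ε ^ 2 / 4)⁻¹).abs
    rwa [mul_zero, abs_zero] at this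
  exact hfreq ((hlim.eventually_lt_const hε).mono fun j hj => not_lt.2 hj.le)

/-- A weak form of the Josefson–Nissenzweig theorem, which gives a single sequence that works for
all `ε`. Completeness of `E` is not needed. -/
theorem exists_norm_ge_eventually_le (hE : ¬ FiniteDimensional ℝ E) {ε : ℝ} (hε : 0 < ε) :
    ∃ h : ℕ → StrongDual ℝ E, (∀ n, 1 ≤ ‖h n‖) ∧
      ∀ x, ∀ᶠ n in atTop, |h n x| ≤ ε * ‖x‖ := by
  have := not_detectsNorm hE hε
  simp only [DetectsNorm] at this
  push Not at this
  obtain ⟨h, hh, hle⟩ := this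
  refine ⟨h, hh, fun x => ?_⟩
  rcases eq_or_ne x 0 with rfl | hx
  · simp
  have hx' : 0 < ‖x‖ := norm_pos_iff.2 hx
  filter_upwards [hle (‖x‖⁻¹ • x) (by rw [norm_smul, norm_inv, norm_norm, inv_mul_cancel₀ hx'.ne'])]
    with n hn
  rw [map_smul, smul_eq_mul, abs_mul, abs_inv, abs_norm, inv_mul_le_iff₀ hx'] at hn
  linarith

end JosefsonNissenzweig

end FilterUBP

namespace FilterUBP

open Filter Topology

/-! ### Failure of the uniform boundedness principles -/

section UniformBoundedness

variable {𝕜 : Type} [RCLike 𝕜] {X : Type u} [NormedAddCommGroup X] [NormedSpace 𝕜 X]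

/-- On an infinite-dimensional space there are functionals of arbitrarily large norm that are
eventually bounded by `‖x‖` at each point `x`. Over `ℂ`, they are obtained by extending real
functionals. -/
lemma exists_strongDual_norm_ge (hX : ¬ FiniteDimensional 𝕜 X) {c : ℝ} (hc : 0 < c) :
    ∃ S : ℕ → StrongDual 𝕜 X, (∀ n, c ≤ ‖S n‖) ∧ ∀ x, ∀ᶠ n in atTop, ‖S n x‖ ≤ ‖x‖ := by
  let _ : NormedSpace ℝ X := NormedSpace.restrictScalars ℝ 𝕜 X
  have : IsScalarTower ℝ 𝕜 X := RestrictScalars.isScalarTower ℝ 𝕜 X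
  have hX' : ¬ FiniteDimensional ℝ X := fun _ => hX (FiniteDimensional.right ℝ 𝕜 X)
  obtain ⟨h, hh, hle⟩ := exists_norm_ge_eventually_le hX' (ε := (2 * c)⁻¹) (by positivity)
  refine ⟨fun n => (c : 𝕜) • (h n).extendRCLike, fun n => ?_, fun x => ?_⟩
  · rw [norm_smul, RCLike.norm_ofReal, abs_of_pos hc]
    refine le_mul_of_one_le_right hc.le ((hh n).trans ?_)
    refine (h n).opNorm_le_bound (norm_nonneg _) fun x => ?_
    rw [← StrongDual.re_extendRCLike_apply (𝕜 := 𝕜) (h n) x]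
    exact (RCLike.abs_re_le_norm _).trans (ContinuousLinearMap.le_opNorm _ x)
  · filter_upwards [hle x, hle ((RCLike.I : 𝕜) • x)] with n h1 h2
    rw [smul_apply, norm_smul, RCLike.norm_ofReal, abs_of_pos hc,
      StrongDual.extendRCLike_apply]
    have hI : ‖(RCLike.I : 𝕜)‖ ≤ 1 := by
      rcases RCLike.I_eq_zero_or_im_I_eq_one (K := 𝕜) with h | h
      · simp [h]
      · exact (RCLike.norm_I_of_ne_zero (by rintro h0; simp [h0] at h)).le
    have h3 : ‖(h n x : 𝕜) - RCLike.I * (h n ((RCLike.I : 𝕜) • x) : 𝕜)‖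
        ≤ |h n x| + |h n ((RCLike.I : 𝕜) • x)| := by
      refine (norm_sub_le _ _).trans (add_le_add (RCLike.norm_ofReal _).le ?_)
      rw [norm_mul, RCLike.norm_ofReal]
      exact mul_le_of_le_one_left (abs_nonneg _) hI
    have h4 : ‖(RCLike.I : 𝕜) • x‖ ≤ ‖x‖ := by
      rw [norm_smul]
      exact mul_le_of_le_one_left (norm_nonneg _) hI
    calc c * ‖(h n x : 𝕜) - RCLike.I * (h n ((RCLike.I : 𝕜) • x) : 𝕜)‖
        ≤ c * ((2 * c)⁻¹ * ‖x‖ + (2 * c)⁻¹ * ‖x‖) := by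
          gcongr
          refine h3.trans (add_le_add h1 (h2.trans ?_))
          gcongr
      _ = ‖x‖ := by field_simp; ring

/-- If a decreasing sequence `A` has no pseudo-intersection inside `W` that is stationary for the
filter `F`, then there is a pointwise `F`-bounded sequence of functionals `T` that is far from
equicontinuous along `W`: for every neighbourhood `U` of `0`, the indices `i ∈ W` for which `T i`
maps `U` into the unit ball lie outside some fixed `A C`, or in all of the `A k`. -/
lemma exists_pointwiseFBounded (hX : ¬ FiniteDimensional 𝕜 X) {F : Filter ℕ} {A : ℕ → Set ℕ}
    (hA : Antitone A) {W : Set ℕ}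
    (hW : ∀ B ⊆ W, (∀ k, AlmostSubset B (A k)) → ¬ Stationary F B) :
    ∃ T : ℕ → X →L[𝕜] ULift.{v} 𝕜, PointwiseFBounded F T ∧ ∀ U ∈ 𝓝 (0 : X), ∃ C : ℕ,
      ∀ i ∈ W, T i '' U ⊆ Metric.closedBall 0 1 → i ∉ A C ∨ ∀ k, i ∈ A k := by
  classical
  choose S hS hSx using fun k : ℕ =>
    exists_strongDual_norm_ge (𝕜 := 𝕜) hX (c := k + 1) (by positivity)
  -- The index `i` uses the family of the first level `k` with `i ∉ A k`.
  let R : ℕ → StrongDual 𝕜 X := fun i =>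
    if h : i ∈ W ∧ ∃ k, i ∉ A k then S (Nat.find h.2) i else 0
  let e : 𝕜 ≃L[𝕜] ULift.{v} 𝕜 := ContinuousLinearEquiv.ulift.symm
  have he : ∀ z, ‖e z‖ = ‖z‖ := fun _ => rfl
  refine ⟨fun i => e.toContinuousLinearMap ∘L R i, fun x U hU => ?_, fun U hU => ?_⟩
  · let B : Set ℕ := {i | i ∈ W ∧ (∃ k, i ∉ A k) ∧ ‖x‖ < ‖R i x‖}
    have hB : ∀ k, AlmostSubset B (A k) := by
      intro k
      have hfin : (⋃ j ∈ Finset.range (k + 1), {i | ‖x‖ < ‖S j i x‖}).Finite := by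
        refine (Finset.range (k + 1)).finite_toSet.biUnion fun j _ => ?_
        have := hSx j x
        rw [← Nat.cofinite_eq_atTop, eventually_cofinite] at this
        simpa using this
      refine hfin.subset ?_
      rintro i ⟨⟨hiW, hex, hlt⟩, hi⟩
      simp only [R, dif_pos (show i ∈ W ∧ ∃ k, i ∉ A k from ⟨hiW, hex⟩)] at hlt
      simp only [Set.mem_iUnion, Finset.mem_range]
      exact ⟨_, Nat.lt_succ_of_le (Nat.find_le hi), hlt⟩
    have hBF : Bᶜ ∈ F := not_not.1 (hW B (fun i hi => hi.1) hB)
    obtain ⟨ρ, hρ, hball⟩ := Metric.nhds_basis_closedBall.mem_iff.1 hU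
    refine ⟨ρ / (‖x‖ + 1), by positivity, ?_⟩
    filter_upwards [hBF] with i hi
    apply hball
    have hle : ‖R i x‖ ≤ ‖x‖ := by
      by_cases h : i ∈ W ∧ ∃ k, i ∉ A k
      · by_contra! hlt
        exact hi ⟨h.1, h.2, hlt⟩
      · simp [R, dif_neg h]
    rw [mem_closedBall_zero_iff, norm_smul, RCLike.norm_ofReal, abs_of_pos (by positivity),
      ContinuousLinearMap.comp_apply, ContinuousLinearEquiv.coe_coe, he, div_mul_eq_mul_div,
      div_le_iff₀ (by positivity)]
    gcongr
    linarith
  · obtain ⟨r, hr, hball⟩ := Metric.nhds_basis_closedBall.mem_iff.1 hU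
    obtain ⟨C, hC⟩ := exists_nat_ge (1 / r)
    refine ⟨C, fun i hiW himg => ?_⟩
    by_cases hex : ∃ k, i ∉ A k
    · left
      have h : i ∈ W ∧ ∃ k, i ∉ A k := ⟨hiW, hex⟩
      have hnorm : ‖R i‖ ≤ 1 / r := by
        refine ContinuousLinearMap.opNorm_bound_of_ball_bound hr 1 (R i) fun z hz => ?_
        simpa [he] using himg ⟨z, hball hz, rfl⟩
      simp only [R, dif_pos h] at hnorm
      have hk : Nat.find hex ≤ C := by
        have := (hS _ i).trans (hnorm.trans hC)
        have : ((Nat.find hex : ℕ) : ℝ) ≤ C := by linarith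
        exact_mod_cast this
      exact fun hi => Nat.find_spec hex (hA hk hi)
    · right
      push Not at hex
      exact hex

lemma almostSubset_of_subset {A B : Set ℕ} (h : A ⊆ B) : AlmostSubset A B := by
  simp [AlmostSubset, Set.sdiff_eq_empty.2 h]

lemma isPPlus_of_ubp (hX : ¬ FiniteDimensional 𝕜 X) {F : Filter ℕ} (h : UBP.{v} 𝕜 F X) :
    IsPPlus F := by
  intro A hA hstat
  by_contra! hno
  have hW : ∀ B ⊆ (Set.univ : Set ℕ), (∀ k, AlmostSubset B (A k)) → ¬ Stationary F B := by
    intro B _ hB hBF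
    obtain ⟨k, hk⟩ := hno B hBF
    exact hk (hB k)
  obtain ⟨T, hT, hTU⟩ := exists_pointwiseFBounded.{u, v} (𝕜 := 𝕜) hX hA hW
  have hT' : FEquicontinuous F T := by
    have : T ∈ {T : ℕ → X →L[𝕜] ULift.{v} 𝕜 | PointwiseFBounded F T} := hT
    rwa [h (ULift.{v} 𝕜)] at this
  obtain ⟨U, hU, hev⟩ := hT' _ (Metric.closedBall_mem_nhds 0 one_pos)
  obtain ⟨C, hC⟩ := hTU U hU
  have hcap : (⋂ k, A k)ᶜ ∈ F := not_not.1 <| hW _ (Set.subset_univ _) fun k =>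
    almostSubset_of_subset (Set.iInter_subset A k)
  refine hstat C ?_
  filter_upwards [hev, hcap] with i hi hicap
  exact (hC i (Set.mem_univ i) hi).resolve_right fun hall => hicap (Set.mem_iInter.2 hall)

lemma isWeakPPlus_of_statUBP (hX : ¬ FiniteDimensional 𝕜 X) {F : Filter ℕ}
    (h : StatUBP.{v} 𝕜 F X) : IsWeakPPlus F := by
  intro A hA hAF I hI
  by_contra! hno
  have hW : ∀ B ⊆ I, (∀ k, AlmostSubset B (A k)) → ¬ Stationary F B := by
    intro B hBI hB hBF
    obtain ⟨k, hk⟩ := hno B hBI hBF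
    exact hk (hB k)
  obtain ⟨T, hT, hTU⟩ := exists_pointwiseFBounded.{u, v} (𝕜 := 𝕜) hX hA hW
  obtain ⟨U, hU, J, hJ, hJI, hJU⟩ :=
    h (ULift.{v} 𝕜) T hT I hI _ (Metric.closedBall_mem_nhds 0 one_pos)
  obtain ⟨C, hC⟩ := hTU U hU
  have hcap : (I ∩ ⋂ k, A k)ᶜ ∈ F := not_not.1 <| hW _ Set.inter_subset_left fun k =>
    almostSubset_of_subset (Set.inter_subset_right.trans (Set.iInter_subset A k))
  refine hJ ?_
  filter_upwards [hAF C, hcap] with i hiC hicap hiJ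
  rcases hC i (hJI hiJ) (hJU i hiJ) with hi | hi
  · exact hi hiC
  · exact hicap ⟨hJI hiJ, Set.mem_iInter.2 hi⟩

end UniformBoundedness

end FilterUBP

theorem mainTheorem4 {𝕜 : Type} [RCLike 𝕜]
    (X : Type u) [NormedAddCommGroup X] [NormedSpace 𝕜 X] (hX : ¬ FiniteDimensional 𝕜 X)
    (F : Filter ℕ) [F.NeBot] (hF : F ≤ Filter.cofinite) :
    (FilterUBP.UBP.{v} 𝕜 F X → FilterUBP.IsPPlus F) ∧
      (FilterUBP.StatUBP.{v} 𝕜 F X → FilterUBP.IsWeakPPlus F) :=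
  ⟨FilterUBP.isPPlus_of_ubp hX, FilterUBP.isWeakPPlus_of_statUBP hX⟩
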